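/- Let $A$ be a unital $C^*$-algebra with a normalized faithful trace $\tau$ (a faithful tracial state), and let $E$ be a Hilbert $C^*$-module over $A$ with $A$-valued inner product $\langle\cdot|\cdot\rangle$, linear in the second entry. Let $\mathcal L_A(E)$ be the $C^*$-algebra of adjointable operators on $E$, let $\mathcal F_A(E)$ be the linear span of the operators $\pi_{x,y}(z)=x\langle y|z\rangle$ with $x,y\in E$, and let $\mathcal K_A(E)$, the algebra of $A$-compact operators, be the norm closure of $\mathcal F_A(E)$. Let $\operatorname{tr}_\tau$ be the linear functional on $\mathcal F_A(E)$ with $\operatorname{tr}_\tau(\pi_{x,y})=\tau(\langle y|x\rangle)$. For $0\le T\in\mathcal L_A(E)$ put $$\operatorname{tr}_\tau(T)=\sup\{\operatorname{tr}_\tau(S) : S\in\mathcal F_A(E),\ 0\le S\le T\}\in[0,\infty],$$ and call $T\in\mathcal L_A(E)$ of $\operatorname{tr}_\tau$-trace class if $\operatorname{tr}_\tau(|T|)<\infty$. An unbounded operator $D$ on $E$ is called $A$-elliptic if it is $A$-linear and densely defined, its adjoint $D^*$ is densely defined, $1+D^*D$ has dense range, and $(1+D^*D)^{-1}\in\mathcal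 K_A(E)$. It is self-adjoint if it is densely defined and $D=D^*$. A subset of $\mathbb R$ has band structure if it is the union of a locally finite family of closed intervals (bounded or unbounded, single points allowed). **Theorem.** Assume that $\mathcal K_A(E)$ has the Kadison property with respect to $\operatorname{tr}_\tau$, i.e. $$c_K=\inf\{\operatorname{tr}_\tau(P) : 0\ne P\in\mathcal K_A(E)\text{ a projection}\}>0 .$$ Then for every self-adjoint $A$-elliptic operator $D$ on $E$ such that $e^{-tD^2}$ is of $\operatorname{tr}_\tau$-trace class for some $t>0$, the spectrum of $D$ is contained in $\mathbb R$ and has band structure. -/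

import Mathlib

set_option linter.unusedSectionVars false

open scoped InnerProductSpace ComplexOrder

noncomputable section

namespace BlochTheory

section Adjointable

variable (A E : Type*) [CStarAlgebra A] [PartialOrder A] [StarOrderedRing A]
  [NormedAddCommGroup E] [NormedSpace ℂ E] [Module A E] [CStarModule A E]

variable {A E} in
theorem ext_inner {x y : E} (h : ∀ z : E, ⟪z, x⟫_A = ⟪z, y⟫_A) : x = y := by
  rw [← sub_eq_zero, ← CStarModule.inner_self (A := A), CStarModule.inner_sub_right, h, sub_self]

variable {A E} in
theorem norm_module_smul_le (a : A) (x : E) : ‖a • x‖ ≤ ‖a‖ * ‖x‖ := by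
  refine (sq_le_sq₀ (norm_nonneg _) (by positivity)).1 ?_
  rw [CStarModule.norm_sq_eq A, CStarModule.inner_op_smul_right, CStarModule.inner_op_smul_left,
    mul_pow, CStarModule.norm_sq_eq A (x := x)]
  calc ‖a * (⟪x, x⟫_A * star a)‖ ≤ ‖a‖ * (‖⟪x, x⟫_A‖ * ‖star a‖) :=
        (norm_mul_le _ _).trans (by gcongr; exact norm_mul_le _ _)
    _ = _ := by rw [norm_star]; ring

/-- The algebra `L_A(E)` of adjointable operators on the Hilbert module `E`.

Convention: in Mathlib's `CStarModule A E` the coefficient `a` is written on the left, and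
`⟪x, a • y⟫ = a * ⟪x, y⟫`. This is a right Hilbert module over the opposite algebra of `A`; since
the opposite of a C*-algebra is a C*-algebra with the same positive elements and the same traces,
quantifying over all `A` covers all right Hilbert modules. -/
def adjointable : Subalgebra ℂ (E →L[ℂ] E) where
  carrier := {T | ∃ S : E →L[ℂ] E, ∀ x y, ⟪S x, y⟫_A = ⟪x, T y⟫_A}
  mul_mem' := by
    rintro T₁ T₂ ⟨S₁, h₁⟩ ⟨S₂, h₂⟩
    exact ⟨S₂ * S₁, fun x y => by simp [h₁, h₂]⟩
  add_mem' := by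
    rintro T₁ T₂ ⟨S₁, h₁⟩ ⟨S₂, h₂⟩
    exact ⟨S₁ + S₂, fun x y => by simp [h₁, h₂]⟩
  algebraMap_mem' := fun c =>
    ⟨star c • 1, fun x y => by simp [Algebra.algebraMap_eq_smul_one]⟩

variable {A E}

instance : CoeFun (adjointable A E) (fun _ => E → E) := ⟨fun T => (T : E →L[ℂ] E)⟩

theorem adj_ext {S T : adjointable A E} (h : ∀ x, S x = T x) : S = T :=
  Subtype.ext (ContinuousLinearMap.ext h)

instance : Star (adjointable A E) where
  star T := ⟨T.2.choose, T, fun x y => by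
    rw [← CStarModule.star_inner, ← T.2.choose_spec, CStarModule.star_inner]⟩

theorem inner_star_left (T : adjointable A E) (x y : E) : ⟪(star T) x, y⟫_A = ⟪x, T y⟫_A :=
  T.2.choose_spec x y

theorem inner_star_right (T : adjointable A E) (x y : E) : ⟪x, (star T) y⟫_A = ⟪T x, y⟫_A := by
  rw [← CStarModule.star_inner, inner_star_left, CStarModule.star_inner]

@[simp] theorem adj_mul_apply (S T : adjointable A E) (x : E) : (S * T) x = S (T x) := rfl
@[simp] theorem adj_add_apply (S T : adjointable A E) (x : E) : (S + T) x = S x + T x := rfl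
@[simp] theorem adj_smul_apply (c : ℂ) (T : adjointable A E) (x : E) : (c • T) x = c • T x := rfl

theorem adj_sum_apply {ι : Type*} (s : Finset ι) (T : ι → adjointable A E) (x : E) :
    (∑ i ∈ s, T i) x = ∑ i ∈ s, (T i) x := by
  simp

/-- Adjointable operators are linear over the coefficient algebra. -/
theorem adj_map_smul (T : adjointable A E) (a : A) (x : E) : T (a • x) = a • T x := by
  refine ext_inner (A := A) fun z => ?_
  rw [← inner_star_left, CStarModule.inner_op_smul_right, CStarModule.inner_op_smul_right,
    inner_star_left]

instance : StarRing (adjointable A E) where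
  star_involutive T := adj_ext fun x => ext_inner (A := A) fun z => by
    rw [inner_star_right, inner_star_left]
  star_mul S T := adj_ext fun x => ext_inner (A := A) fun z => by
    rw [inner_star_right, adj_mul_apply, adj_mul_apply, inner_star_right, inner_star_right]
  star_add S T := adj_ext fun x => ext_inner (A := A) fun z => by
    rw [inner_star_right, adj_add_apply, adj_add_apply, CStarModule.inner_add_right,
      CStarModule.inner_add_left, inner_star_right, inner_star_right]

instance : StarModule ℂ (adjointable A E) where
  star_smul c T := adj_ext fun x => ext_inner (A := A) fun z => by
    rw [inner_star_right, adj_smul_apply, adj_smul_apply, CStarModule.inner_smul_left_complex,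
      CStarModule.inner_smul_right_complex, inner_star_right]

instance : CStarRing (adjointable A E) where
  norm_mul_self_le T := by
    have key : ∀ x : E, ‖T x‖ ≤ √‖star T * T‖ * ‖x‖ := fun x => by
      refine (sq_le_sq₀ (norm_nonneg _) (by positivity)).1 ?_
      rw [mul_pow, Real.sq_sqrt (norm_nonneg (star T * T)), CStarModule.norm_sq_eq A, ← inner_star_right,
        ← adj_mul_apply]
      calc _ ≤ ‖x‖ * ‖(star T * T) x‖ := CStarModule.norm_inner_le E
        _ ≤ ‖x‖ * (‖star T * T‖ * ‖x‖) := by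
          gcongr
          exact ((star T * T : adjointable A E) : E →L[ℂ] E).le_opNorm x
        _ = _ := by ring
    have h : ‖T‖ ≤ √‖star T * T‖ :=
      ContinuousLinearMap.opNorm_le_bound (T : E →L[ℂ] E) (by positivity) key
    calc ‖T‖ * ‖T‖ ≤ √‖star T * T‖ * √‖star T * T‖ := by gcongr
      _ = _ := Real.mul_self_sqrt (norm_nonneg _)

instance [CompleteSpace E] : CompleteSpace (adjointable A E) := by
  refine Metric.complete_of_cauchySeq_tendsto fun u hu => ?_
  have hu' : CauchySeq fun n => star (u n) := by
    rw [cauchySeq_iff_tendsto_dist_atTop_0] at hu ⊢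
    refine hu.congr fun n => ?_
    have h2 : star (u n.1 - u n.2) = star (u n.1) - star (u n.2) := star_sub _ _
    rw [dist_eq_norm, dist_eq_norm, ← h2]
    exact (norm_star (u n.1 - u n.2)).symm
  have hc {v : ℕ → adjointable A E} (hv : CauchySeq v) :
      CauchySeq fun n => (v n : E →L[ℂ] E) := by
    rw [cauchySeq_iff_tendsto_dist_atTop_0] at hv ⊢
    exact hv
  obtain ⟨T, hT⟩ := cauchySeq_tendsto_of_complete (hc hu)
  obtain ⟨S, hS⟩ := cauchySeq_tendsto_of_complete (hc hu')
  have hcont (L : E →L[ℂ] E) (v : ℕ → E →L[ℂ] E) (hv : Filter.Tendsto v Filter.atTop (nhds L))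
      (x : E) : Filter.Tendsto (fun n => v n x) Filter.atTop (nhds (L x)) :=
    ((ContinuousLinearMap.apply ℂ E x).continuous.tendsto L).comp hv
  have h1 (x y : E) : ⟪S x, y⟫_A = ⟪x, T y⟫_A := by
    have hl := (CStarModule.continuous_inner (A := A) (E := E)).tendsto (S x, y) |>.comp
      ((hcont S _ hS x).prodMk_nhds tendsto_const_nhds)
    have hr := (CStarModule.continuous_inner (A := A) (E := E)).tendsto (x, T y) |>.comp
      (tendsto_const_nhds.prodMk_nhds (hcont T _ hT y))
    refine tendsto_nhds_unique hl (hr.congr fun n => ?_)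
    exact (inner_star_left (u n) x y).symm
  exact ⟨⟨T, S, h1⟩, tendsto_subtype_rng.2 hT⟩

instance [CompleteSpace E] : CStarAlgebra (adjointable A E) where

instance [CompleteSpace E] : PartialOrder (adjointable A E) := CStarAlgebra.spectralOrder _

instance [CompleteSpace E] : StarOrderedRing (adjointable A E) :=
  CStarAlgebra.spectralOrderedRing _

end Adjointable

section FiniteRank

variable (A : Type*) {E : Type*} [CStarAlgebra A] [PartialOrder A] [StarOrderedRing A]
  [NormedAddCommGroup E] [NormedSpace ℂ E] [Module A E] [CStarModule A E]

/-- The operator `π_{x,y}`, which sends `z` to `x` multiplied by the coefficient `⟪y, z⟫`. -/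
def rankOne (x y : E) : adjointable A E :=
  have h (u v z : E) : ‖⟪v, z⟫_A • u‖ ≤ (‖v‖ * ‖u‖) * ‖z‖ :=
    calc _ ≤ ‖⟪v, z⟫_A‖ * ‖u‖ := norm_module_smul_le _ _
      _ ≤ (‖v‖ * ‖z‖) * ‖u‖ := by gcongr; exact CStarModule.norm_inner_le E
      _ = _ := by ring
  let op (u v : E) : E →L[ℂ] E := LinearMap.mkContinuous
    { toFun := fun z => ⟪v, z⟫_A • u
      map_add' := fun z w => by rw [CStarModule.inner_add_right, add_smul]
      map_smul' := fun c z => ext_inner (A := A) fun w => by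
        rw [CStarModule.inner_smul_right_complex, CStarModule.inner_op_smul_right,
          RingHom.id_apply, CStarModule.inner_smul_right_complex,
          CStarModule.inner_op_smul_right, smul_mul_assoc] } _ (h u v)
  ⟨op x y, op y x, fun z w => by
    change ⟪⟪x, z⟫_A • y, w⟫_A = ⟪z, ⟪y, w⟫_A • x⟫_A
    rw [CStarModule.inner_op_smul_left, CStarModule.inner_op_smul_right, CStarModule.star_inner]⟩

variable {A}

theorem rankOne_apply (x y z : E) : rankOne A x y z = ⟪y, z⟫_A • x := rfl

variable (A E) in
/-- The `A`-finite operators: the linear span of the operators `π_{x,y}`. -/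
def finiteOps : Submodule ℂ (adjointable A E) :=
  Submodule.span ℂ (Set.range fun p : E × E => rankOne A p.1 p.2)

variable (A E) in
/-- The `A`-compact operators: the norm closure of the `A`-finite operators. -/
def compactOps : Submodule ℂ (adjointable A E) := (finiteOps A E).topologicalClosure

end FiniteRank

section Trace

/-- A normalized faithful trace on a unital C*-algebra: a faithful tracial state. -/
structure FaithfulTrace (A : Type*) [CStarAlgebra A] [PartialOrder A] [StarOrderedRing A]
    extends A →ₚ[ℂ] ℂ where
  map_one' : toFun 1 = 1
  map_mul_comm' : ∀ a b, toFun (a * b) = toFun (b * a)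
  faithful' : ∀ a, toFun (star a * a) = 0 → a = 0

variable {A E : Type*} [CStarAlgebra A] [PartialOrder A] [StarOrderedRing A]
  [NormedAddCommGroup E] [NormedSpace ℂ E] [Module A E] [CStarModule A E]

instance : CoeFun (FaithfulTrace A) (fun _ => A → ℂ) := ⟨fun τ => τ.toPositiveLinearMap⟩

theorem FaithfulTrace.mul_comm (τ : FaithfulTrace A) (a b : A) : τ (a * b) = τ (b * a) :=
  τ.map_mul_comm' a b

theorem FaithfulTrace.continuous (τ : FaithfulTrace A) : Continuous τ := by
  obtain ⟨C, hC⟩ := τ.toPositiveLinearMap.exists_norm_apply_le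
  exact AddMonoidHomClass.continuous_of_bound τ.toPositiveLinearMap C hC

/-- `∑ c_p π_{x_p,y_p}` for a formal combination of pairs `p = (x_p, y_p)`. -/
def opOfPairs : (E × E →₀ ℂ) →ₗ[ℂ] adjointable A E :=
  Finsupp.linearCombination ℂ fun p => rankOne A p.1 p.2

/-- `∑ c_p τ(⟪y_p, x_p⟫)` for a formal combination of pairs `p = (x_p, y_p)`. -/
def traceOfPairs (τ : FaithfulTrace A) : (E × E →₀ ℂ) →ₗ[ℂ] ℂ :=
  Finsupp.linearCombination ℂ fun p => τ ⟪p.2, p.1⟫_A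

theorem opOfPairs_apply (f : E × E →₀ ℂ) (z : E) :
    opOfPairs (A := A) f z = f.sum fun p c => c • ⟪p.2, z⟫_A • p.1 := by
  rw [opOfPairs, Finsupp.linearCombination_apply, Finsupp.sum, adj_sum_apply]
  rfl

/-- The algebraic form of the trace property. -/
theorem sum_trace_rankOne (τ : FaithfulTrace A) (f : E × E →₀ ℂ) (u v : E) :
    (f.sum fun p c => c * τ ⟪p.2, rankOne A u v p.1⟫_A)
      = τ ⟪v, opOfPairs (A := A) f u⟫_A := by
  rw [opOfPairs_apply, Finsupp.sum, Finsupp.sum, CStarModule.inner_sum_right, map_sum]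
  refine Finset.sum_congr rfl fun p _ => ?_
  rw [rankOne_apply, CStarModule.inner_op_smul_right, CStarModule.inner_smul_right_complex,
    CStarModule.inner_op_smul_right, map_smul, smul_eq_mul, τ.mul_comm]

theorem sum_trace_eq_zero (τ : FaithfulTrace A) {f : E × E →₀ ℂ}
    (hf : opOfPairs (A := A) f = 0) {e : adjointable A E} (he : e ∈ finiteOps A E) :
    (f.sum fun p c => c * τ ⟪p.2, e p.1⟫_A) = 0 := by
  induction he using Submodule.span_induction with
  | mem e h =>
    obtain ⟨⟨u, v⟩, rfl⟩ := h
    rw [sum_trace_rankOne, hf]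
    change τ ⟪v, (0 : E)⟫_A = 0
    rw [CStarModule.inner_zero_right, map_zero]
  | zero =>
    refine Finset.sum_eq_zero fun p _ => ?_
    change f p * τ ⟪p.2, (0 : E)⟫_A = 0
    rw [CStarModule.inner_zero_right, map_zero, mul_zero]
  | add S T _ _ hS hT =>
    rw [Finsupp.sum] at *
    simp only [adj_add_apply, CStarModule.inner_add_right, map_add, mul_add,
      Finset.sum_add_distrib, hS, hT, add_zero]
  | smul c T _ hT =>
    rw [Finsupp.sum] at *
    simp only [adj_smul_apply, CStarModule.inner_smul_right_complex, map_smul, smul_eq_mul,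
      mul_left_comm _ c, ← Finset.mul_sum, hT, mul_zero]

theorem star_rankOne_self (x : E) : star (rankOne A x x) = rankOne A x x :=
  adj_ext fun z => ext_inner (A := A) fun w => by
    rw [inner_star_right, rankOne_apply, rankOne_apply, CStarModule.inner_op_smul_left,
      CStarModule.inner_op_smul_right, CStarModule.star_inner]

theorem mul_rankOne (T : adjointable A E) (x y : E) : T * rankOne A x y = rankOne A (T x) y :=
  adj_ext fun z => by rw [adj_mul_apply, rankOne_apply, rankOne_apply, adj_map_smul]

theorem mul_mem_finiteOps (T : adjointable A E) {e : adjointable A E} (he : e ∈ finiteOps A E) :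
    T * e ∈ finiteOps A E := by
  induction he using Submodule.span_induction with
  | mem e h =>
    obtain ⟨⟨u, v⟩, rfl⟩ := h
    exact Submodule.subset_span ⟨(T u, v), (mul_rankOne T u v).symm⟩
  | zero => rw [mul_zero]; exact Submodule.zero_mem _
  | add S T _ _ hS hT => rw [mul_add]; exact Submodule.add_mem _ hS hT
  | smul c T _ hT => rw [mul_smul_comm]; exact Submodule.smul_mem _ _ hT

variable [CompleteSpace E]

/-- On finitely many vectors the identity is approximated by `A`-finite operators. -/
theorem exists_approx (s : Finset E) {ε : ℝ} (hε : 0 < ε) :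
    ∃ e ∈ finiteOps A E, ∀ x ∈ s, ‖x - e x‖ ≤ ε := by
  set h : adjointable A E := ∑ x ∈ s, rankOne A x x with hh
  have hsa : IsSelfAdjoint h := by
    rw [IsSelfAdjoint, hh, star_sum]
    exact Finset.sum_congr rfl fun x _ => star_rankOne_self x
  have hmem : h ∈ finiteOps A E :=
    Submodule.sum_mem _ fun x _ => Submodule.subset_span ⟨(x, x), rfl⟩
  obtain ⟨n, hn0, hn⟩ : ∃ n : ℝ, 0 < n ∧ 1 / (2 * √n) ≤ ε ^ 2 := by
    refine ⟨(1 / (2 * ε ^ 2)) ^ 2, by positivity, ?_⟩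
    rw [Real.sqrt_sq (by positivity)]
    field_simp
    rfl
  have hpos (t : ℝ) : 1 + n * t ^ 2 ≠ 0 := by positivity
  let k : adjointable A E := cfc (fun t : ℝ => n * t / (1 + n * t ^ 2)) h
  let g : adjointable A E := cfc (fun t : ℝ => 1 / (1 + n * t ^ 2)) h
  have hg : IsSelfAdjoint g := cfc_predicate _ _
  have hc1 : Continuous fun t : ℝ => n * t / (1 + n * t ^ 2) := by fun_prop (disch := exact hpos _)
  have hc2 : Continuous fun t : ℝ => 1 / (1 + n * t ^ 2) := by fun_prop (disch := exact hpos _)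
  have hid : cfc (fun t : ℝ => t) h = h := cfc_id' ℝ h
  have hgk : g = 1 - k * h := by
    have h1 : k * h = cfc (fun t : ℝ => n * t / (1 + n * t ^ 2) * t) h := by
      rw [cfc_mul _ (fun t : ℝ => t) h hc1.continuousOn continuous_id'.continuousOn, hid]
    rw [h1, ← cfc_const_one ℝ h, ← cfc_sub (fun _ : ℝ => (1 : ℝ))
      (fun t : ℝ => n * t / (1 + n * t ^ 2) * t) h continuous_const.continuousOn
      (hc1.mul continuous_id').continuousOn]
    refine cfc_congr fun t _ => ?_
    have := hpos t
    field_simp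
    ring
  have hghg : ‖g * h * g‖ ≤ ε ^ 2 := by
    have h1 : g * h * g =
        cfc (fun t : ℝ => 1 / (1 + n * t ^ 2) * t * (1 / (1 + n * t ^ 2))) h := by
      rw [cfc_mul (fun t : ℝ => 1 / (1 + n * t ^ 2) * t) _ h
          (hc2.mul continuous_id').continuousOn hc2.continuousOn,
        cfc_mul _ (fun t : ℝ => t) h hc2.continuousOn continuous_id'.continuousOn, hid]
    rw [h1]
    refine (norm_cfc_le (by positivity) fun t _ => ?_).trans hn
    have hs : 0 < √n := Real.sqrt_pos.2 hn0
    have hs2 : √n ^ 2 = n := Real.sq_sqrt hn0.le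
    have ht : 0 < 1 + n * t ^ 2 := by positivity
    have h2 : |t| ≤ 1 / (2 * √n) * (1 + n * t ^ 2) := by
      rw [div_mul_eq_mul_div, one_mul, le_div_iff₀ (by positivity), ← sq_abs t]
      rw [show n * |t| ^ 2 = √n ^ 2 * |t| ^ 2 by rw [hs2]]
      nlinarith [sq_nonneg (√n * |t| - 1)]
    rw [Real.norm_eq_abs, abs_mul, abs_mul, abs_of_pos (show 0 < 1 / (1 + n * t ^ 2) by positivity)]
    have h3 : 1 / (1 + n * t ^ 2) ≤ 1 := by
      rw [div_le_one ht]
      nlinarith [sq_nonneg t, mul_nonneg hn0.le (sq_nonneg t)]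
    calc 1 / (1 + n * t ^ 2) * |t| * (1 / (1 + n * t ^ 2))
        ≤ 1 / (1 + n * t ^ 2) * (1 / (2 * √n) * (1 + n * t ^ 2)) * 1 := by gcongr
      _ = 1 / (2 * √n) := by field_simp
  refine ⟨k * h, mul_mem_finiteOps k hmem, fun x hx => ?_⟩
  have hx1 : x - (k * h) x = g x := by rw [hgk]; rfl
  rw [hx1]
  have hle : ⟪g x, g x⟫_A * ⟪g x, g x⟫_A ≤ ⟪g x, (g * h * g) (g x)⟫_A := by
    have hgi (a b : E) : ⟪a, g b⟫_A = ⟪g a, b⟫_A := by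
      have := inner_star_right g a b
      rwa [hg.star_eq] at this
    have h1 : ⟪g x, (g * h * g) (g x)⟫_A
        = ∑ y ∈ s, ⟪y, g (g x)⟫_A * ⟪g (g x), y⟫_A := by
      rw [adj_mul_apply, adj_mul_apply, hgi, hh, adj_sum_apply, CStarModule.inner_sum_right]
      exact Finset.sum_congr rfl fun y _ => by
        rw [rankOne_apply, CStarModule.inner_op_smul_right]
    have h2 : ⟪g x, g x⟫_A * ⟪g x, g x⟫_A = ⟪x, g (g x)⟫_A * ⟪g (g x), x⟫_A := by
      rw [hgi x (g x), ← hgi (g x) x]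
    rw [h1, h2]
    refine Finset.single_le_sum (f := fun y => ⟪y, g (g x)⟫_A * ⟪g (g x), y⟫_A) (fun y _ => ?_) hx
    rw [← CStarModule.star_inner y]
    exact mul_star_self_nonneg _
  have hnn : 0 ≤ ⟪g x, g x⟫_A * ⟪g x, g x⟫_A := by
    have := mul_star_self_nonneg ⟪g x, g x⟫_A
    rwa [CStarModule.star_inner] at this
  have hnorm := CStarAlgebra.norm_le_norm_of_nonneg_of_le hnn hle
  have hl : ‖⟪g x, g x⟫_A * ⟪g x, g x⟫_A‖ = (‖g x‖ ^ 2) ^ 2 := by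
    have := CStarRing.norm_self_mul_star (x := ⟪g x, g x⟫_A)
    rw [CStarModule.star_inner] at this
    rw [this, CStarModule.norm_sq_eq A, sq]
  have hr : ‖⟪g x, (g * h * g) (g x)⟫_A‖ ≤ ε ^ 2 * ‖g x‖ ^ 2 :=
    calc _ ≤ ‖g x‖ * ‖(g * h * g) (g x)‖ := CStarModule.norm_inner_le E
      _ ≤ ‖g x‖ * (‖g * h * g‖ * ‖g x‖) := by
        gcongr
        exact ((g * h * g : adjointable A E) : E →L[ℂ] E).le_opNorm _
      _ ≤ ‖g x‖ * (ε ^ 2 * ‖g x‖) := by gcongr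
      _ = _ := by ring
  rw [hl] at hnorm
  rcases (norm_nonneg (g x)).eq_or_lt with h0 | h0
  · rw [← h0]
    exact hε.le
  · refine (sq_le_sq₀ h0.le hε.le).1 ?_
    have : 0 < ‖g x‖ ^ 2 := by positivity
    nlinarith [hnorm.trans hr]

theorem traceOfPairs_eq_zero (τ : FaithfulTrace A) {f : E × E →₀ ℂ}
    (hf : opOfPairs (A := A) f = 0) : traceOfPairs τ f = 0 := by
  classical
  choose e he hex using fun n : ℕ =>
    exists_approx (A := A) (f.support.image Prod.fst) (Nat.one_div_pos_of_nat (α := ℝ) (n := n))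
  have hlim (x : E) (hx : x ∈ f.support.image Prod.fst) :
      Filter.Tendsto (fun n => e n x) Filter.atTop (nhds x) := by
    rw [tendsto_iff_norm_sub_tendsto_zero]
    refine squeeze_zero (fun n => norm_nonneg _) (fun n => ?_)
      tendsto_one_div_add_atTop_nhds_zero_nat
    rw [norm_sub_rev]
    exact hex n x hx
  have h1 : Filter.Tendsto (fun n => f.sum fun p c => c * τ ⟪p.2, e n p.1⟫_A) Filter.atTop
      (nhds (f.sum fun p c => c * τ ⟪p.2, p.1⟫_A)) := by
    refine tendsto_finsetSum _ fun p hp => Filter.Tendsto.const_mul _ ?_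
    refine (τ.continuous.tendsto _).comp ?_
    exact ((CStarModule.continuous_inner (A := A) (E := E)).tendsto (p.2, p.1)).comp
      (tendsto_const_nhds.prodMk_nhds (hlim p.1 (Finset.mem_image_of_mem _ hp)))
  simp only [fun n => sum_trace_eq_zero τ hf (he n)] at h1
  exact (tendsto_nhds_unique h1 tendsto_const_nhds)

theorem exists_pairs (S : finiteOps A E) : ∃ f, opOfPairs (A := A) f = (S : adjointable A E) := by
  have h : (S : adjointable A E) ∈
      Submodule.span ℂ (Set.range fun p : E × E => rankOne A p.1 p.2) := S.2
  rw [← Finsupp.range_linearCombination] at h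
  exact h

theorem traceOfPairs_congr (τ : FaithfulTrace A) {f g : E × E →₀ ℂ}
    (h : opOfPairs (A := A) f = opOfPairs g) : traceOfPairs τ f = traceOfPairs τ g := by
  rw [← sub_eq_zero, ← map_sub]
  exact traceOfPairs_eq_zero τ (by rw [map_sub, h, sub_self])

/-- The trace `tr_τ` on the `A`-finite operators: the linear functional with
`tr_τ(π_{x,y}) = τ(⟪y, x⟫)`, see `finiteTrace_rankOne`. It does not depend on the chosen
representation by `traceOfPairs_congr`. -/
def finiteTrace (τ : FaithfulTrace A) : finiteOps A E →ₗ[ℂ] ℂ where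
  toFun S := traceOfPairs τ (exists_pairs S).choose
  map_add' S T := by
    rw [← map_add]
    refine traceOfPairs_congr τ ?_
    rw [map_add, (exists_pairs (S + T)).choose_spec, (exists_pairs S).choose_spec,
      (exists_pairs T).choose_spec]
    rfl
  map_smul' c S := by
    rw [RingHom.id_apply, ← map_smul]
    refine traceOfPairs_congr τ ?_
    rw [map_smul, (exists_pairs (c • S)).choose_spec, (exists_pairs S).choose_spec]
    rfl

theorem rankOne_mem (x y : E) : rankOne A x y ∈ finiteOps A E :=
  Submodule.subset_span ⟨(x, y), rfl⟩

theorem finiteTrace_rankOne (τ : FaithfulTrace A) (x y : E) :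
    finiteTrace τ ⟨rankOne A x y, rankOne_mem x y⟩ = τ ⟪y, x⟫_A := by
  have h : traceOfPairs τ (Finsupp.single (x, y) 1) = τ ⟪y, x⟫_A := by
    simp [traceOfPairs]
  rw [← h]
  refine traceOfPairs_congr τ ?_
  rw [(exists_pairs _).choose_spec]
  simp [opOfPairs]

/-- The canonical extension of `tr_τ` to the positive adjointable operators, with values in
`[0, ∞]`: the supremum of `tr_τ(S)` over the `A`-finite `S` with `0 ≤ S ≤ T`. -/
def posTrace (τ : FaithfulTrace A) (T : adjointable A E) : ENNReal :=
  ⨆ S : {S : finiteOps A E // 0 ≤ (S : adjointable A E) ∧ (S : adjointable A E) ≤ T},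
    ENNReal.ofReal (finiteTrace τ S.1).re

/-- Membership in the trace class ideal: `tr_τ(|T|) < ∞`. -/
def IsTraceClass (τ : FaithfulTrace A) (T : adjointable A E) : Prop :=
  posTrace τ (CFC.abs T) < ⊤

variable (E) in
/-- The Kadison constant of the algebra of `A`-compact operators with respect to `tr_τ`. -/
def kadisonConstant (τ : FaithfulTrace A) : ENNReal :=
  ⨅ P : {P : adjointable A E // P ∈ compactOps A E ∧ IsStarProjection P ∧ P ≠ 0}, posTrace τ P.1

variable (E) in
/-- The Kadison property: nonzero projections in the algebra of `A`-compact operators have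
traces bounded away from zero. -/
def HasKadisonProperty (τ : FaithfulTrace A) : Prop := 0 < kadisonConstant E τ

end Trace

section Unbounded

variable {A E : Type*} [CStarAlgebra A] [PartialOrder A] [StarOrderedRing A]
  [NormedAddCommGroup E] [NormedSpace ℂ E] [Module A E] [CStarModule A E]

/-- The graph of the adjoint of an unbounded operator `D` on a Hilbert module: the pairs `(y, z)`
with `⟪D x, y⟫ = ⟪x, z⟫` for all `x` in the domain of `D`. -/
def adjointGraph (D : E →ₗ.[A] E) : Submodule A (E × E) where
  carrier := {p | ∀ x : D.domain, ⟪D x, p.1⟫_A = ⟪(x : E), p.2⟫_A}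
  add_mem' := fun hp hq x => by
    rw [Prod.fst_add, Prod.snd_add, CStarModule.inner_add_right, CStarModule.inner_add_right,
      hp x, hq x]
  zero_mem' := fun x => by
    rw [Prod.fst_zero, Prod.snd_zero, CStarModule.inner_zero_right, CStarModule.inner_zero_right]
  smul_mem' := fun a p hp x => by
    rw [Prod.smul_fst, Prod.smul_snd, CStarModule.inner_op_smul_right,
      CStarModule.inner_op_smul_right, hp x]

/-- The adjoint `D*` of a densely defined operator `D`. -/
def adjoint (D : E →ₗ.[A] E) : E →ₗ.[A] E := (adjointGraph D).toLinearPMap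

theorem adjoint_graph (D : E →ₗ.[A] E) (hD : Dense (D.domain : Set E)) :
    (adjoint D).graph = adjointGraph D := by
  refine Submodule.toLinearPMap_graph_eq _ fun p hp hp0 => ?_
  have hcont : Continuous fun x : E => ⟪x, p.2⟫_A :=
    (CStarModule.continuous_inner (A := A) (E := E)).comp (.prodMk_left p.2)
  have h0 : (fun x : E => ⟪x, p.2⟫_A) = fun _ => 0 := by
    refine hcont.ext_on hD continuous_const fun x hx => ?_
    have := hp ⟨x, hx⟩
    rw [hp0, CStarModule.inner_zero_right] at this
    exact this.symm
  exact CStarModule.inner_self.1 (congrFun h0 p.2)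

/-- A self-adjoint operator: densely defined with `D* = D`. -/
def IsSelfAdjointOp (D : E →ₗ.[A] E) : Prop :=
  Dense (D.domain : Set E) ∧ adjoint D = D

/-- `x` lies in the domain of `D*D`, and `(1 + D*D) x = y`. -/
def OneAddAdjMul (D : E →ₗ.[A] E) (x y : E) : Prop :=
  ∃ (hx : x ∈ D.domain) (hDx : D ⟨x, hx⟩ ∈ (adjoint D).domain),
    x + adjoint D ⟨D ⟨x, hx⟩, hDx⟩ = y

/-- The bounded operator `S` is `(1 + D*D)⁻¹`. If `1 + D*D` has dense range, there is at most
one such operator. -/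
def IsInvOneAddAdjMul (D : E →ₗ.[A] E) (S : adjointable A E) : Prop :=
  ∀ x y, OneAddAdjMul D x y → S y = x

/-- `A`-elliptic operators: densely defined; regular, that is with a densely defined adjoint `D*`
and dense range of `1 + D*D`; with `A`-compact resolvent `(1 + D*D)⁻¹`. -/
structure IsElliptic (D : E →ₗ.[A] E) : Prop where
  dense_domain : Dense (D.domain : Set E)
  dense_adjoint_domain : Dense ((adjoint D).domain : Set E)
  dense_range : Dense {y | ∃ x, OneAddAdjMul D x y}
  compact_resolvent : ∃ S ∈ compactOps A E, IsInvOneAddAdjMul D S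

/-- The spectrum of an unbounded operator: the `z` for which `z - D` does not have a bounded
adjointable inverse. -/
def opSpectrum (D : E →ₗ.[A] E) : Set ℂ :=
  {z | ¬ ∃ R : adjointable A E, (∀ y, ∃ h : R y ∈ D.domain, z • R y - D ⟨R y, h⟩ = y) ∧
    ∀ x : D.domain, R (z • (x : E) - D x) = x}

open scoped Classical in
/-- The operator `(1 + D*D)⁻¹`, with value `0` if there is none. -/
def invOneAddAdjMul (D : E →ₗ.[A] E) : adjointable A E :=
  if h : ∃ S, IsInvOneAddAdjMul D S then h.choose else 0

/-- The continuous function on `[0, 1]` with `heatFun t (1 / (1 + x²)) = exp (-t x²)`. -/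
def heatFun (t s : ℝ) : ℝ := if s ≤ 0 then 0 else Real.exp (-t * (s⁻¹ - 1))

/-- The heat operator `exp(-t D*D)`, that is `exp(-t D²)` if `D` is self-adjoint, obtained by
continuous functional calculus from `(1 + D*D)⁻¹`. -/
def heatOp [CompleteSpace E] (D : E →ₗ.[A] E) (t : ℝ) : adjointable A E :=
  cfc (heatFun t) (invOneAddAdjMul D)

end Unbounded

/-- Band structure: a locally finite union of closed intervals (bounded or not, points allowed). -/
def HasBandStructure (S : Set ℝ) : Prop :=
  ∃ 𝓘 : Set (Set ℝ), (∀ I ∈ 𝓘, IsClosed I ∧ I.OrdConnected) ∧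
    LocallyFinite (fun I : 𝓘 => (I : Set ℝ)) ∧ S = ⋃₀ 𝓘

end BlochTheory

end

/-!
The proof transfers all questions about `D` to the bounded normal operator `R = (D + i)⁻¹`. Since
`1 + D² = (D + i) (D - i)` has dense range and `D` is closed, `D ± i` are bijections from the
domain of `D` onto `E` (`IsSelfAdjointOp.surjective_add`), and their inverses are adjoint to each
other (`IsSelfAdjointOp.exists_resolvent`). The resolvent identity gives `R* - R = 2i R* R`, so `R`
is normal with spectrum on the circle `Im z = -|z|²`, the closure of the image of `ℝ` under
`x ↦ (x + i)⁻¹`. This map carries the spectrum of `D` onto the nonzero part of the spectrum of `R`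
(`IsResolvent.mem_opSpectrum_iff`), which shows that the spectrum of `D` is real and closed.

For real `a < b` in the resolvent set the indicator function of `(a, b)`, seen as a function
on the spectrum of `R`, is continuous, and defines a projection `P` by functional calculus. It is a
multiple of `R* R = (1 + D²)⁻¹`, hence `A`-compact (`IsResolvent.band_mem_compactOps`), and it is
nonzero as soon as `(a, b)` meets the spectrum, so that its trace is then at least the Kadison
constant. The trace is superadditive, so a chain `r₀ < ⋯ < rₙ` of resolvent points with spectrum in
each gap gives a projection of trace at least `n` times the Kadison constant
(`IsResolvent.nat_mul_kadisonConstant_le`). If the chain lies in `[-M, M]`, this projection is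
dominated by a multiple, depending only on `M` and `t`, of the heat operator
(`IsResolvent.band_le_heatOp`), which has finite trace. So `n` is bounded in terms of `M`, and a
closed set with this property is the union of the locally finite family of its connected components
(`hasBandStructure_of_gaps`).
-/

noncomputable section

namespace BlochTheory

/-! ### The resolvents of a regular self-adjoint operator at `∓i` -/

section Resolvent

variable {A E : Type*} [CStarAlgebra A] [PartialOrder A] [StarOrderedRing A]
  [NormedAddCommGroup E] [NormedSpace ℂ E] [Module A E] [CStarModule A E]

theorem complex_smul_eq_algebraMap_smul (c : ℂ) (x : E) : c • x = (algebraMap ℂ A c) • x :=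
  ext_inner (A := A) fun z => by
    rw [CStarModule.inner_smul_right_complex, CStarModule.inner_op_smul_right,
      Algebra.smul_def]

theorem complex_smul_mem (G : Submodule A (E × E)) (c : ℂ) {x u : E} (h : (x, u) ∈ G) :
    (c • x, c • u) ∈ G := by
  rw [complex_smul_eq_algebraMap_smul (A := A) c x, complex_smul_eq_algebraMap_smul (A := A) c u]
  exact G.smul_mem (algebraMap ℂ A c) h

theorem isClosed_adjointGraph (D : E →ₗ.[A] E) : IsClosed (adjointGraph D : Set (E × E)) := by
  have h : (adjointGraph D : Set (E × E)) =
      ⋂ x : D.domain, {p : E × E | ⟪D x, p.1⟫_A = ⟪(x : E), p.2⟫_A} := by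
    ext p
    simp only [Set.mem_iInter]
    rfl
  have hc (y : E) : Continuous fun x : E => ⟪y, x⟫_A :=
    (CStarModule.continuous_inner (A := A) (E := E)).comp (.prodMk_right y)
  rw [h]
  exact isClosed_iInter fun x =>
    isClosed_eq ((hc _).comp continuous_fst) ((hc _).comp continuous_snd)

theorem IsSelfAdjointOp.graph_eq {D : E →ₗ.[A] E} (h : IsSelfAdjointOp D) :
    D.graph = adjointGraph D := by
  conv_lhs => rw [← h.2]
  exact adjoint_graph D h.1

theorem IsSelfAdjointOp.inner_eq {D : E →ₗ.[A] E} (h : IsSelfAdjointOp D) {x u y v : E}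
    (hx : (x, u) ∈ D.graph) (hy : (y, v) ∈ D.graph) : ⟪u, y⟫_A = ⟪x, v⟫_A := by
  obtain ⟨x', rfl, rfl⟩ := (LinearPMap.mem_graph_iff D).1 hx
  rw [h.graph_eq] at hy
  exact hy x'

/-- For imaginary `c = ±i`, the cross terms in `⟪(D + c) x, (D + c) x⟫` cancel and leave
`⟪D x, D x⟫ + ⟪x, x⟫`. -/
theorem IsSelfAdjointOp.norm_le {D : E →ₗ.[A] E} (h : IsSelfAdjointOp D) {c : ℂ}
    (hc : star c = -c) (hc2 : c * c = -1) {x u : E} (hx : (x, u) ∈ D.graph) :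
    ‖x‖ ≤ ‖u + c • x‖ := by
  have key : ⟪u + c • x, u + c • x⟫_A = ⟪u, u⟫_A + ⟪x, x⟫_A := by
    simp only [CStarModule.inner_add_left, CStarModule.inner_add_right,
      CStarModule.inner_smul_left_complex, CStarModule.inner_smul_right_complex, hc,
      h.inner_eq hx hx, neg_smul]
    simp [smul_smul, hc2]
  refine (sq_le_sq₀ (norm_nonneg _) (norm_nonneg _)).1 ?_
  rw [CStarModule.norm_sq_eq A, CStarModule.norm_sq_eq A (x := u + c • x), key]
  exact CStarAlgebra.norm_le_norm_of_nonneg_of_le CStarModule.inner_self_nonneg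
    (le_add_of_nonneg_left CStarModule.inner_self_nonneg)

theorem IsSelfAdjointOp.oneAddAdjMul_iff {D : E →ₗ.[A] E} (h : IsSelfAdjointOp D) {x y : E} :
    OneAddAdjMul D x y ↔ ∃ u, (x, u) ∈ D.graph ∧ (u, y - x) ∈ D.graph := by
  constructor
  · rintro ⟨hx, hDx, rfl⟩
    refine ⟨D ⟨x, hx⟩, LinearPMap.mem_graph D ⟨x, hx⟩, ?_⟩
    have h1 := LinearPMap.mem_graph (adjoint D) ⟨D ⟨x, hx⟩, hDx⟩
    rw [congrArg LinearPMap.graph h.2] at h1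
    rwa [add_sub_cancel_left]
  · rintro ⟨u, hxu, huy⟩
    have hx : x ∈ D.domain := LinearPMap.mem_domain_of_mem_graph hxu
    obtain rfl : u = D ⟨x, hx⟩ := (LinearPMap.image_iff hx).2 hxu
    rw [← congrArg LinearPMap.graph h.2] at huy
    have hDx := LinearPMap.mem_domain_of_mem_graph huy
    refine ⟨hx, hDx, ?_⟩
    rw [← (LinearPMap.image_iff hDx).2 huy, add_sub_cancel]

variable [CompleteSpace E]

/-- `D + c` is onto for `c = ±i`: its range contains the dense range of
`1 + D² = (D + c) (D - c)`, and it is closed because `D` is closed and `D + c` is bounded below. -/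
theorem IsSelfAdjointOp.surjective_add {D : E →ₗ.[A] E} (h : IsSelfAdjointOp D)
    (hd : Dense {y | ∃ x, OneAddAdjMul D x y}) {c : ℂ} (hc : star c = -c) (hc2 : c * c = -1)
    (y : E) : ∃ x, (x, y - c • x) ∈ D.graph := by
  set W : Set E := {y | ∃ x, (x, y - c • x) ∈ D.graph}
  have hsub : {y | ∃ x, OneAddAdjMul D x y} ⊆ W := by
    rintro y ⟨x, hx⟩
    obtain ⟨u, hu, hv⟩ := h.oneAddAdjMul_iff.1 hx
    refine ⟨u - c • x, ?_⟩
    have h1 := D.graph.sub_mem hv (complex_smul_mem D.graph c hu)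
    have h2 : y - c • (u - c • x) = y - x - c • u := by
      rw [smul_sub, smul_smul, hc2]
      module
    rw [h2]
    exact h1
  have hcl : IsClosed W := by
    refine isClosed_of_closure_subset fun y hy => ?_
    obtain ⟨v, hv, hvy⟩ := mem_closure_iff_seq_limit.1 hy
    choose x hx using hv
    have hcs : CauchySeq x := by
      have hvc := hvy.cauchySeq
      rw [Metric.cauchySeq_iff'] at hvc ⊢
      intro ε hε
      obtain ⟨N, hN⟩ := hvc ε hε
      refine ⟨N, fun n hn => lt_of_le_of_lt ?_ (hN n hn)⟩
      rw [dist_eq_norm, dist_eq_norm]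
      have h1 := h.norm_le hc hc2 (D.graph.sub_mem (hx n) (hx N))
      refine h1.trans_eq (congrArg _ ?_)
      change v n - c • x n - (v N - c • x N) + c • (x n - x N) = _
      module
    obtain ⟨z, hz⟩ := cauchySeq_tendsto_of_complete hcs
    refine ⟨z, ?_⟩
    have hG : IsClosed (D.graph : Set (E × E)) := by
      rw [h.graph_eq]
      exact isClosed_adjointGraph D
    exact hG.mem_of_tendsto (hz.prodMk_nhds (hvy.sub (hz.const_smul c)))
      (Filter.Eventually.of_forall hx)
  have hall : W = Set.univ := by
    rw [← hcl.closure_eq]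
    exact (hd.mono hsub).closure_eq
  exact (Set.eq_univ_iff_forall.1 hall) y

/-- The bounded operator `(D + c)⁻¹` for `c = ±i`. -/
theorem IsSelfAdjointOp.exists_inv_add {D : E →ₗ.[A] E} (h : IsSelfAdjointOp D)
    (hd : Dense {y | ∃ x, OneAddAdjMul D x y}) {c : ℂ} (hc : star c = -c) (hc2 : c * c = -1) :
    ∃ R : E →L[ℂ] E, ∀ y, (R y, y - c • R y) ∈ D.graph := by
  choose r hr using h.surjective_add hd hc hc2
  have hb {x y : E} (hx : (x, y - c • x) ∈ D.graph) : ‖x‖ ≤ ‖y‖ := by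
    simpa using h.norm_le hc hc2 hx
  have huniq {x x' y : E} (hx : (x, y - c • x) ∈ D.graph) (hx' : (x', y - c • x') ∈ D.graph) :
      x = x' := by
    have h1 : (x - x', 0 - c • (x - x')) ∈ D.graph := by
      have h2 := D.graph.sub_mem hx hx'
      rw [Prod.mk_sub_mk] at h2
      convert h2 using 2
      module
    rw [← sub_eq_zero, ← norm_le_zero_iff]
    simpa using hb h1
  refine ⟨LinearMap.mkContinuous
    { toFun := r
      map_add' := fun y z => huniq (hr _) ?_
      map_smul' := fun a y => huniq (hr _) ?_ } 1 fun y => ?_, fun y => hr y⟩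
  · have h2 := D.graph.add_mem (hr y) (hr z)
    rw [Prod.mk_add_mk] at h2
    convert h2 using 2
    module
  · have h2 := complex_smul_mem D.graph a (hr y)
    rw [RingHom.id_apply]
    convert h2 using 2
    module
  · rw [one_mul]
    exact hb (hr y)

/-- `R` is the resolvent `(D + i)⁻¹` and `R*` is the resolvent `(D - i)⁻¹` of `D`. -/
structure IsResolvent (D : E →ₗ.[A] E) (R : adjointable A E) : Prop where
  mem : ∀ y, (R y, y - Complex.I • R y) ∈ D.graph
  star_mem : ∀ y, ((star R) y, y + Complex.I • (star R) y) ∈ D.graph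

/-- The operator `(D + i)⁻¹` is adjointable, with adjoint `(D - i)⁻¹`: the relation
`⟪(D - i)⁻¹ x, y⟫ = ⟪x, (D + i)⁻¹ y⟫` is the symmetry of `D` at the preimages of `x` and `y`. -/
theorem IsSelfAdjointOp.exists_resolvent {D : E →ₗ.[A] E} (h : IsSelfAdjointOp D)
    (hd : Dense {y | ∃ x, OneAddAdjMul D x y}) :
    ∃ R : adjointable A E, IsResolvent D R := by
  obtain ⟨R, hR⟩ := h.exists_inv_add hd (c := Complex.I) (by simp) (by simp)
  obtain ⟨R', hR'⟩ := h.exists_inv_add hd (c := -Complex.I) (by simp) (by simp)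
  have hadj (x y : E) : ⟪R' x, y⟫_A = ⟪x, R y⟫_A := by
    have h1 := h.inner_eq (hR' x) (hR y)
    simp only [CStarModule.inner_sub_left, CStarModule.inner_sub_right,
      CStarModule.inner_smul_left_complex, CStarModule.inner_smul_right_complex] at h1
    simpa using h1.symm
  refine ⟨⟨R, R', hadj⟩, hR, fun y => ?_⟩
  have h1 : (star (⟨R, R', hadj⟩ : adjointable A E)) y = R' y :=
    ext_inner (A := A) fun z => by
      rw [inner_star_right, ← CStarModule.star_inner, ← CStarModule.star_inner (R' y), hadj]
  have h2 := hR' y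
  rw [h1]
  rwa [neg_smul, sub_neg_eq_add] at h2

end Resolvent

/-! ### The spectrum of the operator and the spectrum of its resolvent -/

section ResolventSpectrum

variable {A E : Type*} [CStarAlgebra A] [PartialOrder A] [StarOrderedRing A]
  [NormedAddCommGroup E] [NormedSpace ℂ E] [Module A E] [CStarModule A E]

namespace IsResolvent

variable {D : E →ₗ.[A] E} {R : adjointable A E}

theorem apply_add (hR : IsResolvent D R) (h : IsSelfAdjointOp D) {x u : E}
    (hx : (x, u) ∈ D.graph) : R (u + Complex.I • x) = x := by
  have h1 := D.graph.sub_mem (hR.mem (u + Complex.I • x)) hx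
  have h2 := h.norm_le (c := Complex.I) (by simp) (by simp) h1
  rw [← sub_eq_zero, ← norm_le_zero_iff]
  refine h2.trans_eq (norm_eq_zero.2 ?_)
  change u + Complex.I • x - Complex.I • R (u + Complex.I • x) - u
    + Complex.I • (R (u + Complex.I • x) - x) = 0
  module

theorem star_apply_sub (hR : IsResolvent D R) (h : IsSelfAdjointOp D) {x u : E}
    (hx : (x, u) ∈ D.graph) : (star R) (u - Complex.I • x) = x := by
  have h1 := D.graph.sub_mem (hR.star_mem (u - Complex.I • x)) hx
  have h2 := h.norm_le (c := -Complex.I) (by simp) (by simp) h1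
  rw [← sub_eq_zero, ← norm_le_zero_iff]
  refine h2.trans_eq (norm_eq_zero.2 ?_)
  change u - Complex.I • x + Complex.I • (star R) (u - Complex.I • x) - u
    + (-Complex.I) • ((star R) (u - Complex.I • x) - x) = 0
  module

/-- The resolvent identity for `(D - i)⁻¹` and `(D + i)⁻¹`. -/
theorem star_sub_self_eq (hR : IsResolvent D R) (h : IsSelfAdjointOp D) :
    star R - R = (2 * Complex.I) • (star R * R) := by
  refine adj_ext fun y => ?_
  have h1 := hR.star_apply_sub h (hR.mem y)
  change (star R) y - R y = (2 * Complex.I) • (star R) (R y)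
  rw [map_sub, map_sub, map_smul] at h1
  nth_rewrite 1 [← h1]
  module

theorem star_sub_self_eq' (hR : IsResolvent D R) (h : IsSelfAdjointOp D) :
    star R - R = (2 * Complex.I) • (R * star R) := by
  refine adj_ext fun y => ?_
  have h1 := hR.apply_add h (hR.star_mem y)
  change (star R) y - R y = (2 * Complex.I) • R ((star R) y)
  rw [map_add, map_add, map_smul] at h1
  nth_rewrite 1 [← h1]
  module

theorem isStarNormal (hR : IsResolvent D R) (h : IsSelfAdjointOp D) : IsStarNormal R := by
  refine ⟨?_⟩
  have h1 := (hR.star_sub_self_eq h).symm.trans (hR.star_sub_self_eq' h)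
  exact smul_right_injective _ (by simp : (2 * Complex.I) ≠ 0) h1

theorem eq_of_isInvOneAddAdjMul (hR : IsResolvent D R) (h : IsSelfAdjointOp D)
    {S : adjointable A E} (hS : IsInvOneAddAdjMul D S) : S = star R * R := by
  rw [(hR.isStarNormal h).star_comm_self]
  refine adj_ext fun y => hS _ _ ?_
  rw [h.oneAddAdjMul_iff]
  have h1 := hR.star_mem y
  have h2 := hR.mem ((star R) y)
  refine ⟨_, h2, ?_⟩
  have h3 := D.graph.sub_mem h1 (complex_smul_mem D.graph Complex.I h2)
  rw [Prod.mk_sub_mk] at h3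
  convert h3 using 2
  rw [smul_sub, smul_smul, Complex.I_mul_I, adj_mul_apply]
  module

theorem invOneAddAdjMul_eq (hR : IsResolvent D R) (h : IsSelfAdjointOp D)
    (hS : ∃ S, IsInvOneAddAdjMul D S) : invOneAddAdjMul D = star R * R := by
  rw [invOneAddAdjMul, dif_pos hS]
  exact hR.eq_of_isInvOneAddAdjMul h hS.choose_spec

end IsResolvent

theorem notMem_opSpectrum_iff {D : E →ₗ.[A] E} {w : ℂ} :
    w ∉ opSpectrum D ↔ ∃ Q : adjointable A E, (∀ y, (Q y, w • Q y - y) ∈ D.graph) ∧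
      ∀ x u, (x, u) ∈ D.graph → Q (w • x - u) = x := by
  rw [opSpectrum, Set.mem_ofPred_eq, not_not]
  refine exists_congr fun Q => and_congr (forall_congr' fun y => ?_) ?_
  · constructor
    · rintro ⟨hd, he⟩
      rw [← LinearPMap.image_iff hd]
      rwa [sub_eq_iff_eq_add, ← sub_eq_iff_eq_add']
    · intro hg
      have hd := LinearPMap.mem_domain_of_mem_graph hg
      refine ⟨hd, ?_⟩
      rw [← (LinearPMap.image_iff hd).2 hg]
      abel
  · constructor
    · intro hQ x u hx
      obtain ⟨x', rfl, rfl⟩ := (LinearPMap.mem_graph_iff D).1 hx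
      exact hQ x'
    · intro hQ x
      exact hQ _ _ (LinearPMap.mem_graph D x)

namespace IsResolvent

variable {D : E →ₗ.[A] E} {R : adjointable A E}

theorem neg_I_notMem_opSpectrum (hR : IsResolvent D R) (h : IsSelfAdjointOp D) :
    -Complex.I ∉ opSpectrum D := by
  rw [notMem_opSpectrum_iff]
  refine ⟨-R, fun y => ?_, fun x u hx => ?_⟩
  · have h1 := D.graph.neg_mem (hR.mem y)
    change (-(R y), _ • -(R y) - y) ∈ D.graph
    convert h1 using 1
    rw [Prod.neg_mk]
    congr 1
    module
  · have h1 := hR.apply_add h hx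
    nth_rewrite 2 [← h1]
    change -R (-Complex.I • x - u) = _
    rw [← map_neg]
    congr 1
    module

/-- The spectral mapping `w ↦ (w + i)⁻¹` from `D` to its resolvent `(D + i)⁻¹`. If
`B` inverts `(w + i)⁻¹ - R`, then `(w + i)⁻¹ R B` is up to sign the resolvent of `D` at `w`; if `Q`
is the resolvent of `D` at `w`, then `(w + i) R - 1` and `(w + i) Q - 1` are mutually inverse. -/
theorem mem_opSpectrum_iff (hR : IsResolvent D R) (h : IsSelfAdjointOp D) {w : ℂ}
    (hw : w + Complex.I ≠ 0) :
    w ∈ opSpectrum D ↔ (w + Complex.I)⁻¹ ∈ spectrum ℂ R := by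
  rw [← not_iff_not, notMem_opSpectrum_iff, spectrum.notMem_iff]
  set c := w + Complex.I with hc
  constructor
  · rintro ⟨Q, hQ, hQ'⟩
    have h1 : c • (Q * R) = R + Q := adj_ext fun y => by
      change c • Q (R y) = R y + Q y
      have h2 := hQ' _ _ (hR.mem y)
      nth_rewrite 2 [← h2]
      rw [← map_smul, ← map_add]
      congr 1
      module
    have h1' : c • (R * Q) = R + Q := adj_ext fun y => by
      change c • R (Q y) = R y + Q y
      have h2 := hR.apply_add h (hQ y)
      nth_rewrite 2 [← h2]
      rw [← map_smul, ← map_add]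
      congr 1
      module
    refine ⟨⟨algebraMap ℂ _ c⁻¹ - R, c • (1 - c • Q), ?_, ?_⟩, rfl⟩
    · have e : (algebraMap ℂ (adjointable A E) c⁻¹ - R) * (c • (1 - c • Q)) =
          1 - c • Q - c • R + c • (c • (R * Q)) := by
        simp only [Algebra.algebraMap_eq_smul_one, sub_mul, mul_sub, smul_sub, mul_smul_comm,
          smul_mul_assoc, one_mul, mul_one]
        match_scalars <;> field_simp
      rw [e, h1']
      module
    · have e : (c • (1 - c • Q)) * (algebraMap ℂ (adjointable A E) c⁻¹ - R) =
          1 - c • Q - c • R + c • (c • (Q * R)) := by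
        simp only [Algebra.algebraMap_eq_smul_one, sub_mul, mul_sub, smul_sub, mul_smul_comm,
          smul_mul_assoc, one_mul, mul_one]
        match_scalars <;> field_simp
      rw [e, h1]
      module
  · rintro ⟨⟨a, b, hab, hba⟩, rfl : a = _⟩
    have hcom : Commute R b := by
      have h1 : Commute R (algebraMap ℂ (adjointable A E) c⁻¹ - R) :=
        (Algebra.commute_algebraMap_right c⁻¹ R).sub_right (Commute.refl R)
      calc R * b = b * ((algebraMap ℂ _ c⁻¹ - R) * R) * b := by
            rw [← mul_assoc b, hba, one_mul]
        _ = b * (R * (algebraMap ℂ _ c⁻¹ - R)) * b := by rw [h1.eq]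
        _ = b * R := by rw [mul_assoc, mul_assoc, hab, mul_one]
    have hab' (y : E) : c⁻¹ • b y - R (b y) = y := by
      have h1 := congrArg (fun T : adjointable A E => T y) hab
      rw [Algebra.algebraMap_eq_smul_one, sub_mul, smul_one_mul] at h1
      exact h1
    have hba' (y : E) : c⁻¹ • b y - b (R y) = y := by
      have h1 := congrArg (fun T : adjointable A E => T y) hba
      rw [Algebra.algebraMap_eq_smul_one, mul_sub, mul_smul_one] at h1
      exact h1
    have hcw : w = c - Complex.I := by rw [hc]; ring
    refine ⟨(-c⁻¹) • (R * b), fun y => ?_, fun x u hx => ?_⟩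
    · have h1 := complex_smul_mem D.graph (-c⁻¹) (hR.mem (b y))
      change ((-c⁻¹) • R (b y), w • ((-c⁻¹) • R (b y)) - y) ∈ D.graph
      convert h1 using 2
      nth_rewrite 2 [← hab' y]
      rw [hcw, smul_smul]
      have h2 : (c - Complex.I) * -c⁻¹ = -1 + Complex.I * c⁻¹ := by
        field_simp
        ring
      rw [h2]
      module
    · obtain ⟨y, rfl⟩ : ∃ y, y = u + Complex.I • x := ⟨_, rfl⟩
      have h1 := hR.apply_add h hx
      change (-c⁻¹) • R (b (w • x - u)) = x
      have h2 : w • x - u = c • x - (u + Complex.I • x) := by rw [hcw]; module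
      have h3 : b (w • x - u) = -(c • (u + Complex.I • x)) := by
        rw [h2, map_sub, map_smul]
        nth_rewrite 1 [← h1]
        have h4 := hba' (u + Complex.I • x)
        nth_rewrite 3 [← h4]
        rw [smul_sub, smul_smul, mul_inv_cancel₀ hw]
        module
      rw [h3, map_neg, map_smul, h1, smul_neg, neg_smul, neg_neg, smul_smul, inv_mul_cancel₀ hw,
        one_smul]

variable [CompleteSpace E]

/-- The points of the spectrum of `(D + i)⁻¹` lie on the circle which is the image of the real
line under `x ↦ (x + i)⁻¹`, as a consequence of the resolvent identity. -/
theorem im_eq_of_mem_spectrum (hR : IsResolvent D R) (h : IsSelfAdjointOp D) {z : ℂ}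
    (hz : z ∈ spectrum ℂ R) : z.im = -Complex.normSq z := by
  have hn := hR.isStarNormal h
  have h1 := hR.star_sub_self_eq h
  have h2 : cfc (fun z : ℂ => star z - z) R =
      cfc (fun z : ℂ => (2 * Complex.I) • (star z * z)) R := by
    rw [cfc_sub (fun z : ℂ => star z) (fun z => z) R (by fun_prop) (by fun_prop),
      cfc_smul (2 * Complex.I) (fun z : ℂ => star z * z) R (by fun_prop),
      cfc_mul (fun z : ℂ => star z) (fun z => z) R (by fun_prop) (by fun_prop), cfc_star_id ..,
      cfc_id' ℂ R, h1]
  have h3 := eqOn_of_cfc_eq_cfc h2 (by fun_prop) (by fun_prop) hn hz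
  have h4 := congrArg Complex.im h3
  simp only [RCLike.star_def, ← Complex.normSq_eq_conj_mul_self] at h4
  simp at h4
  linarith

theorem eq_inv_of_mem_spectrum (hR : IsResolvent D R) (h : IsSelfAdjointOp D) {z : ℂ}
    (hz : z ∈ spectrum ℂ R) (h0 : z ≠ 0) : z = ((z⁻¹.re : ℂ) + Complex.I)⁻¹ := by
  rw [eq_comm, inv_eq_iff_eq_inv, Complex.ext_iff]
  have h1 := hR.im_eq_of_mem_spectrum h hz
  have h2 : Complex.normSq z ≠ 0 := by simpa using h0
  refine ⟨by simp, ?_⟩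
  rw [Complex.inv_im, h1]
  field_simp
  simp

theorem opSpectrum_real (hR : IsResolvent D R) (h : IsSelfAdjointOp D) {w : ℂ}
    (hw : w ∈ opSpectrum D) : w = w.re := by
  have hc : w + Complex.I ≠ 0 := fun h0 => by
    rw [eq_neg_of_add_eq_zero_left h0] at hw
    exact hR.neg_I_notMem_opSpectrum h hw
  have h1 := hR.eq_inv_of_mem_spectrum h ((hR.mem_opSpectrum_iff h hc).1 hw) (inv_ne_zero hc)
  rw [inv_inj, add_left_inj, inv_inv] at h1
  simpa using h1

end IsResolvent

theorem ofReal_add_I_ne_zero (x : ℝ) : (x : ℂ) + Complex.I ≠ 0 := fun h => by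
  simpa using congrArg Complex.im h

variable [CompleteSpace E]

theorem IsResolvent.isClosed_real_spectrum {D : E →ₗ.[A] E} {R : adjointable A E}
    (hR : IsResolvent D R) (h : IsSelfAdjointOp D) :
    IsClosed {x : ℝ | (x : ℂ) ∈ opSpectrum D} := by
  have h1 : {x : ℝ | (x : ℂ) ∈ opSpectrum D} =
      (fun x : ℝ => ((x : ℂ) + Complex.I)⁻¹) ⁻¹' spectrum ℂ R := by
    ext x
    exact hR.mem_opSpectrum_iff h (ofReal_add_I_ne_zero x)
  rw [h1]
  refine (spectrum.isClosed R).preimage ?_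
  exact Continuous.inv₀ (by fun_prop) ofReal_add_I_ne_zero

end ResolventSpectrum

/-! ### Monotonicity and superadditivity of the trace -/

section PosTrace

variable {A E : Type*} [CStarAlgebra A] [PartialOrder A] [StarOrderedRing A]
  [NormedAddCommGroup E] [NormedSpace ℂ E] [Module A E] [CStarModule A E] [CompleteSpace E]

theorem le_posTrace (τ : FaithfulTrace A) {T : adjointable A E} (S : finiteOps A E)
    (h0 : 0 ≤ (S : adjointable A E)) (hT : (S : adjointable A E) ≤ T) :
    ENNReal.ofReal (finiteTrace τ S).re ≤ posTrace τ T :=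
  le_iSup (fun S : {S : finiteOps A E // 0 ≤ (S : adjointable A E) ∧ (S : adjointable A E) ≤ T} =>
    ENNReal.ofReal (finiteTrace τ S.1).re) ⟨S, h0, hT⟩

theorem posTrace_mono (τ : FaithfulTrace A) {S T : adjointable A E} (h : S ≤ T) :
    posTrace τ S ≤ posTrace τ T :=
  iSup_le fun F => le_posTrace τ F.1 F.2.1 (F.2.2.trans h)

theorem posTrace_add_le (τ : FaithfulTrace A) {S T : adjointable A E} (hS : 0 ≤ S) (hT : 0 ≤ T) :
    posTrace τ S + posTrace τ T ≤ posTrace τ (S + T) := by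
  have h0 {T : adjointable A E} (hT : 0 ≤ T) :
      Nonempty {F : finiteOps A E // 0 ≤ (F : adjointable A E) ∧ (F : adjointable A E) ≤ T} :=
    ⟨⟨0, le_rfl, hT⟩⟩
  have := h0 hS
  have := h0 hT
  refine ENNReal.iSup_add_iSup_le fun F G => ?_
  rcases le_total (finiteTrace τ F.1).re 0 with hF | hF
  · rw [ENNReal.ofReal_of_nonpos hF, zero_add]
    exact le_posTrace τ G.1 G.2.1 (G.2.2.trans (le_add_of_nonneg_left hS))
  rcases le_total (finiteTrace τ G.1).re 0 with hG | hG
  · rw [ENNReal.ofReal_of_nonpos hG, add_zero]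
    exact le_posTrace τ F.1 F.2.1 (F.2.2.trans (le_add_of_nonneg_right hT))
  rw [← ENNReal.ofReal_add hF hG, ← Complex.add_re, ← map_add]
  exact le_posTrace τ (F.1 + G.1) (add_nonneg F.2.1 G.2.1) (add_le_add F.2.2 G.2.2)

theorem posTrace_smul_le (τ : FaithfulTrace A) {T : adjointable A E} {c : ℝ} (hc : 0 < c) :
    posTrace τ ((c : ℂ) • T) ≤ ENNReal.ofReal c * posTrace τ T := by
  refine iSup_le fun F => ?_
  have hc0 : (0 : ℂ) ≤ ((c⁻¹ : ℝ) : ℂ) := by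
    rw [Complex.zero_le_real]
    positivity
  have hcc : ((c⁻¹ : ℝ) : ℂ) * c = 1 := by
    rw [← Complex.ofReal_mul, inv_mul_cancel₀ hc.ne', Complex.ofReal_one]
  have h1 : ((c⁻¹ : ℝ) : ℂ) • (F.1 : adjointable A E) ≤ T := by
    have h2 := smul_le_smul_of_nonneg_left F.2.2 hc0
    rwa [smul_smul, hcc, one_smul] at h2
  have h3 := le_posTrace τ (((c⁻¹ : ℝ) : ℂ) • F.1) (smul_nonneg hc0 F.2.1) h1
  rw [map_smul, smul_eq_mul, Complex.re_ofReal_mul] at h3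
  refine le_trans (le_of_eq ?_) (mul_le_mul_right h3 (ENNReal.ofReal c))
  rw [← ENNReal.ofReal_mul hc.le, mul_inv_cancel_left₀ hc.ne']

theorem kadisonConstant_le (τ : FaithfulTrace A) {P : adjointable A E} (h1 : P ∈ compactOps A E)
    (h2 : IsStarProjection P) (h3 : P ≠ 0) : kadisonConstant E τ ≤ posTrace τ P :=
  iInf_le (fun P : {P : adjointable A E // P ∈ compactOps A E ∧ IsStarProjection P ∧ P ≠ 0} =>
    posTrace τ P.1) ⟨P, h1, h2, h3⟩

theorem mul_mem_compactOps (T : adjointable A E) {S : adjointable A E}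
    (hS : S ∈ compactOps A E) : T * S ∈ compactOps A E :=
  map_mem_closure (continuous_const_mul T) hS fun _ => mul_mem_finiteOps T

end PosTrace

/-! ### Spectral projections onto the parts of the spectrum between two resolvent points -/

section SpectralProjection

variable {A E : Type*} [CStarAlgebra A] [PartialOrder A] [StarOrderedRing A]
  [NormedAddCommGroup E] [NormedSpace ℂ E] [Module A E] [CStarModule A E]
  {D : E →ₗ.[A] E} {R : adjointable A E}

open scoped Classical in
/-- The indicator function of the interval `(a, b)`, transported to the circle containing the
spectrum of the resolvent `(D + i)⁻¹` by `x = Re z⁻¹`, the inverse of `x ↦ z = (x + i)⁻¹`. -/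
def bandFun (a b : ℝ) (z : ℂ) : ℂ := if z ≠ 0 ∧ a < z⁻¹.re ∧ z⁻¹.re < b then 1 else 0

theorem bandFun_mul_self (a b : ℝ) (z : ℂ) : bandFun a b z * bandFun a b z = bandFun a b z := by
  simp [bandFun]

theorem star_bandFun (a b : ℝ) (z : ℂ) : star (bandFun a b z) = bandFun a b z := by
  rw [bandFun]
  split_ifs <;> simp

theorem bandFun_nonneg (a b : ℝ) (z : ℂ) : 0 ≤ bandFun a b z := by
  rw [bandFun]
  split_ifs <;> simp

theorem continuous_heatFun {t : ℝ} (ht : 0 < t) : Continuous (heatFun t) := by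
  have h1 : heatFun t = fun s => Real.exp t * expNegInvGlue (s / t) := by
    ext s
    rw [heatFun, expNegInvGlue, mul_ite, mul_zero, ← Real.exp_add]
    have h2 : s / t ≤ 0 ↔ s ≤ 0 := by rw [div_le_iff₀ ht, zero_mul]
    simp only [h2]
    congr 2
    rw [inv_div]
    ring
  rw [h1]
  exact continuous_const.mul ((expNegInvGlue.contDiff (n := 0)).continuous.comp
    (continuous_id.div_const t))

theorem heatFun_nonneg (t s : ℝ) : 0 ≤ heatFun t s := by
  rw [heatFun]
  split_ifs <;> positivity

theorem exp_le_heatFun {t d s : ℝ} (ht : 0 < t) (hd : 0 < d) (hs : d ≤ s) :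
    Real.exp (-t * (d⁻¹ - 1)) ≤ heatFun t s := by
  rw [heatFun, if_neg (hd.trans_le hs).not_ge]
  have h1 : s⁻¹ ≤ d⁻¹ := inv_anti₀ hd hs
  refine Real.exp_le_exp.2 ?_
  nlinarith

namespace IsResolvent

variable [CompleteSpace E]

theorem re_inv_mem (hR : IsResolvent D R) (h : IsSelfAdjointOp D) {z : ℂ}
    (hz : z ∈ spectrum ℂ R) (h0 : z ≠ 0) : ((z⁻¹.re : ℝ) : ℂ) ∈ opSpectrum D := by
  rw [hR.mem_opSpectrum_iff h (ofReal_add_I_ne_zero _), ← hR.eq_inv_of_mem_spectrum h hz h0]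
  exact hz

theorem inv_le_norm (hR : IsResolvent D R) (h : IsSelfAdjointOp D) {z : ℂ}
    (hz : z ∈ spectrum ℂ R) (h0 : z ≠ 0) {M : ℝ} (hM : |z⁻¹.re| ≤ M) : (M + 1)⁻¹ ≤ ‖z‖ := by
  have h1 := hR.eq_inv_of_mem_spectrum h hz h0
  rw [h1, norm_inv]
  refine inv_anti₀ (norm_pos_iff.2 (ofReal_add_I_ne_zero _)) ((norm_add_le _ _).trans ?_)
  rw [Complex.norm_real, Complex.norm_I, Real.norm_eq_abs]
  gcongr

theorem inv_le_norm_of_bandFun_ne_zero (hR : IsResolvent D R) (h : IsSelfAdjointOp D) {z : ℂ}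
    (hz : z ∈ spectrum ℂ R) {a b M : ℝ} (ha : |a| ≤ M) (hb : |b| ≤ M)
    (hne : bandFun a b z ≠ 0) : (M + 1)⁻¹ ≤ ‖z‖ := by
  rw [bandFun, ne_eq, ite_eq_right_iff, not_forall] at hne
  obtain ⟨⟨h0, h1, h2⟩, -⟩ := hne
  exact hR.inv_le_norm h hz h0
    (abs_le.2 ⟨(abs_le.1 ha).1.trans h1.le, h2.le.trans (abs_le.1 hb).2⟩)

/-- The indicator function is locally constant on the spectrum of `(D + i)⁻¹` when the end points
lie in the resolvent set. It vanishes near `0`, which corresponds to the point at infinity. -/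
theorem continuousOn_bandFun (hR : IsResolvent D R) (h : IsSelfAdjointOp D) {a b : ℝ}
    (ha : (a : ℂ) ∉ opSpectrum D) (hb : (b : ℂ) ∉ opSpectrum D) :
    ContinuousOn (bandFun a b) (spectrum ℂ R) := by
  intro z hz
  suffices hs : bandFun a b =ᶠ[nhdsWithin z (spectrum ℂ R)] fun _ => bandFun a b z from
    continuousWithinAt_const.congr_of_eventuallyEq hs rfl
  by_cases h0 : z = 0
  · subst h0
    have hpos : (0 : ℝ) < (max |a| |b| + 1)⁻¹ := by positivity
    filter_upwards [self_mem_nhdsWithin,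
      mem_nhdsWithin_of_mem_nhds (Metric.ball_mem_nhds (0 : ℂ) hpos)] with w hw hw'
    have h1 : bandFun a b 0 = 0 := by simp [bandFun]
    rw [h1]
    by_contra hne
    have h2 := hR.inv_le_norm_of_bandFun_ne_zero h hw (le_max_left _ _) (le_max_right _ _) hne
    exact h2.not_gt (by simpa using hw')
  · have hmem := hR.re_inv_mem h hz h0
    have hra : z⁻¹.re ≠ a := fun h1 => ha (h1 ▸ hmem)
    have hrb : z⁻¹.re ≠ b := fun h1 => hb (h1 ▸ hmem)
    have hc : Filter.Tendsto (fun w : ℂ => w⁻¹.re) (nhdsWithin z (spectrum ℂ R))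
        (nhds z⁻¹.re) :=
      ((Complex.continuous_re.tendsto _).comp (tendsto_inv₀ h0)).mono_left nhdsWithin_le_nhds
    have hne : ∀ᶠ w in nhdsWithin z (spectrum ℂ R), w ≠ 0 :=
      mem_nhdsWithin_of_mem_nhds (isOpen_ne.mem_nhds h0)
    have hA : ∀ᶠ w in nhdsWithin z (spectrum ℂ R), (a < w⁻¹.re ↔ a < z⁻¹.re) := by
      rcases hra.lt_or_gt with h1 | h1
      · filter_upwards [hc.eventually_lt_const h1] with w hw
        exact iff_of_false hw.not_gt h1.not_gt
      · filter_upwards [hc.eventually_const_lt h1] with w hw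
        exact iff_of_true hw h1
    have hB : ∀ᶠ w in nhdsWithin z (spectrum ℂ R), (w⁻¹.re < b ↔ z⁻¹.re < b) := by
      rcases hrb.lt_or_gt with h1 | h1
      · filter_upwards [hc.eventually_lt_const h1] with w hw
        exact iff_of_true hw h1
      · filter_upwards [hc.eventually_const_lt h1] with w hw
        exact iff_of_false hw.not_gt h1.not_gt
    filter_upwards [hne, hA, hB] with w h1 h2 h3
    simp only [bandFun, ne_eq, h1, h0, h2, h3]

theorem isStarProjection_band (hR : IsResolvent D R) (h : IsSelfAdjointOp D) {a b : ℝ}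
    (ha : (a : ℂ) ∉ opSpectrum D) (hb : (b : ℂ) ∉ opSpectrum D) :
    IsStarProjection (cfc (bandFun a b) R) := by
  have hc := hR.continuousOn_bandFun h ha hb
  refine ⟨?_, ?_⟩
  · rw [IsIdempotentElem, ← cfc_mul _ _ R hc hc]
    simp only [bandFun_mul_self]
  · rw [IsSelfAdjoint, ← cfc_star]
    simp only [star_bandFun]

theorem star_mul_self_eq_cfc (hR : IsResolvent D R) (h : IsSelfAdjointOp D) :
    star R * R = cfc (fun z : ℂ => ((‖z‖ ^ 2 : ℝ) : ℂ)) R := by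
  have hn := hR.isStarNormal h
  have h1 : (fun z : ℂ => ((‖z‖ ^ 2 : ℝ) : ℂ)) = fun z => star z * z := by
    ext z
    rw [RCLike.star_def, Complex.conj_mul', Complex.ofReal_pow]
  rw [h1, cfc_mul (fun z : ℂ => star z) (fun z => z) R (by fun_prop) (by fun_prop),
    cfc_star_id .., cfc_id' ℂ R]

/-- The projection is compact: it is a multiple of the compact operator `(1 + D²)⁻¹`, which is
given by the function `‖z‖ ^ 2`, bounded below on the support of the indicator function. -/
theorem band_mem_compactOps (hR : IsResolvent D R) (h : IsSelfAdjointOp D)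
    (hcomp : star R * R ∈ compactOps A E) {a b : ℝ}
    (ha : (a : ℂ) ∉ opSpectrum D) (hb : (b : ℂ) ∉ opSpectrum D) :
    cfc (bandFun a b) R ∈ compactOps A E := by
  have hn := hR.isStarNormal h
  have hc := hR.continuousOn_bandFun h ha hb
  set d : ℝ := (max |a| |b| + 1)⁻¹
  have hd0 : 0 < d := by positivity
  have hm (z : ℂ) : 0 < max (‖z‖ ^ 2) (d ^ 2) := lt_max_of_lt_right (by positivity)
  have hk : Continuous fun z : ℂ => (((max (‖z‖ ^ 2) (d ^ 2))⁻¹ : ℝ) : ℂ) :=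
    Complex.continuous_ofReal.comp
      (Continuous.inv₀ (by fun_prop) fun z => (hm z).ne')
  have h1 : cfc (bandFun a b) R =
      cfc (fun z => bandFun a b z * (((max (‖z‖ ^ 2) (d ^ 2))⁻¹ : ℝ) : ℂ)) R * (star R * R) := by
    rw [hR.star_mul_self_eq_cfc h,
      ← cfc_mul (fun z => bandFun a b z * (((max (‖z‖ ^ 2) (d ^ 2))⁻¹ : ℝ) : ℂ)) _ R (hc.mul hk.continuousOn)
      (by fun_prop : ContinuousOn (fun z : ℂ => ((‖z‖ ^ 2 : ℝ) : ℂ)) _)]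
    refine cfc_congr fun z hz => ?_
    by_cases h0 : bandFun a b z = 0
    · simp [h0]
    · have h2 := hR.inv_le_norm_of_bandFun_ne_zero h hz (le_max_left _ _) (le_max_right _ _) h0
      have h3 : d ^ 2 ≤ ‖z‖ ^ 2 := by gcongr
      have h4 := hm z
      rw [max_eq_left h3] at h4
      simp only [max_eq_left h3]
      rw [mul_assoc, ← Complex.ofReal_mul, inv_mul_cancel₀ h4.ne', Complex.ofReal_one, mul_one]
  rw [h1]
  exact mul_mem_compactOps _ hcomp

theorem heatOp_eq_cfc (hR : IsResolvent D R) (h : IsSelfAdjointOp D)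
    (hS : ∃ S, IsInvOneAddAdjMul D S) {t : ℝ} (ht : 0 < t) :
    heatOp D t = cfc (fun z : ℂ => ((heatFun t (‖z‖ ^ 2) : ℝ) : ℂ)) R := by
  have hn := hR.isStarNormal h
  have hf := continuous_heatFun ht
  rw [heatOp, hR.invOneAddAdjMul_eq h hS,
    cfc_real_eq_complex (heatFun t) (IsSelfAdjoint.star_mul_self R), hR.star_mul_self_eq_cfc h,
    ← cfc_comp (fun z : ℂ => ((heatFun t z.re : ℝ) : ℂ)) (fun z : ℂ => ((‖z‖ ^ 2 : ℝ) : ℂ)) R hn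
      (by fun_prop) (by fun_prop)]
  rfl

theorem band_le_heatOp (hR : IsResolvent D R) (h : IsSelfAdjointOp D)
    (hS : ∃ S, IsInvOneAddAdjMul D S) {t : ℝ} (ht : 0 < t) (M : ℝ) {a b : ℝ}
    (ha : (a : ℂ) ∉ opSpectrum D) (hb : (b : ℂ) ∉ opSpectrum D) (haM : |a| ≤ M) (hbM : |b| ≤ M) :
    cfc (bandFun a b) R ≤
      ((Real.exp (t * ((M + 1) ^ 2 - 1)) : ℝ) : ℂ) • heatOp D t := by
  have hf := continuous_heatFun ht
  have hM : 0 ≤ M := (abs_nonneg a).trans haM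
  rw [hR.heatOp_eq_cfc h hS ht, ← cfc_smul _ _ R (by fun_prop)]
  refine cfc_mono (fun z hz => ?_) (hR.continuousOn_bandFun h ha hb) (by fun_prop)
  rw [smul_eq_mul, ← Complex.ofReal_mul]
  by_cases h0 : bandFun a b z = 0
  · rw [h0, Complex.zero_le_real]
    exact mul_nonneg (Real.exp_pos _).le (heatFun_nonneg _ _)
  · have h1 := hR.inv_le_norm_of_bandFun_ne_zero h hz haM hbM h0
    have h2 : ((M + 1)⁻¹) ^ 2 ≤ ‖z‖ ^ 2 := by gcongr
    have h3 := exp_le_heatFun ht (by positivity) h2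
    have h4 : bandFun a b z = ((1 : ℝ) : ℂ) := by
      have h5 := bandFun_mul_self a b z
      rw [Complex.ofReal_one]
      exact mul_right_cancel₀ h0 (h5.trans (one_mul _).symm)
    rw [h4, Complex.real_le_real]
    calc (1 : ℝ) = Real.exp (t * ((M + 1) ^ 2 - 1)) *
          Real.exp (-t * ((((M + 1)⁻¹) ^ 2)⁻¹ - 1)) := by
          rw [← Real.exp_add, inv_pow, inv_inv, neg_mul, add_neg_cancel, Real.exp_zero]
      _ ≤ _ := by gcongr

theorem band_ne_zero (hR : IsResolvent D R) (h : IsSelfAdjointOp D) {a b s : ℝ}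
    (ha : (a : ℂ) ∉ opSpectrum D) (hb : (b : ℂ) ∉ opSpectrum D)
    (hs : (s : ℂ) ∈ opSpectrum D) (has : a < s) (hsb : s < b) :
    cfc (bandFun a b) R ≠ 0 := by
  intro h0
  have hn := hR.isStarNormal h
  rw [← cfc_const_zero ℂ R] at h0
  have hz := (hR.mem_opSpectrum_iff h (ofReal_add_I_ne_zero s)).1 hs
  have h1 := eqOn_of_cfc_eq_cfc h0 (hR.continuousOn_bandFun h ha hb) (by fun_prop) hn hz
  rw [bandFun, if_pos ⟨inv_ne_zero (ofReal_add_I_ne_zero s), by simpa using has,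
    by simpa using hsb⟩] at h1
  exact one_ne_zero h1

theorem band_add_band (hR : IsResolvent D R) (h : IsSelfAdjointOp D) {a b c : ℝ}
    (ha : (a : ℂ) ∉ opSpectrum D) (hb : (b : ℂ) ∉ opSpectrum D) (hc : (c : ℂ) ∉ opSpectrum D)
    (hab : a ≤ b) (hbc : b ≤ c) :
    cfc (bandFun a b) R + cfc (bandFun b c) R = cfc (bandFun a c) R := by
  rw [← cfc_add _ _ _ (hR.continuousOn_bandFun h ha hb) (hR.continuousOn_bandFun h hb hc)]
  refine cfc_congr fun z hz => ?_
  by_cases h0 : z = 0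
  · simp [bandFun, h0]
  have hne : z⁻¹.re ≠ b := fun h1 => hb (h1 ▸ hR.re_inv_mem h hz h0)
  simp only [bandFun, ne_eq, h0, not_false_eq_true, true_and]
  generalize z⁻¹.re = x at hne
  rcases hne.lt_or_gt with h1 | h1
  · simp [h1, h1.not_gt, h1.trans_le hbc]
  · simp [h1, h1.not_gt, hab.trans_lt h1]

/-- Each of the `n` gaps in a chain of resolvent points, if it contains spectrum, contributes at
least the Kadison constant to the trace of the spectral projection of the whole chain. -/
theorem nat_mul_kadisonConstant_le (hR : IsResolvent D R) (h : IsSelfAdjointOp D)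
    (hcomp : star R * R ∈ compactOps A E) (τ : FaithfulTrace A) (r : ℕ → ℝ) (n : ℕ)
    (hr : ∀ i ≤ n, (r i : ℂ) ∉ opSpectrum D)
    (hs : ∀ i < n, ∃ s : ℝ, (s : ℂ) ∈ opSpectrum D ∧ r i < s ∧ s < r (i + 1)) :
    r 0 ≤ r n ∧ n * kadisonConstant E τ ≤ posTrace τ (cfc (bandFun (r 0) (r n)) R) := by
  induction n with
  | zero => simp
  | succ n ih =>
    obtain ⟨h1, h2⟩ := ih (fun i hi => hr i (by lia)) fun i hi => hs i (by lia)
    obtain ⟨s, hsD, hs1, hs2⟩ := hs n (by lia)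
    have hr0 := hr 0 (by lia)
    have hrn := hr n (by lia)
    have hrn' := hr (n + 1) le_rfl
    refine ⟨h1.trans (hs1.trans hs2).le, ?_⟩
    rw [← hR.band_add_band h hr0 hrn hrn' h1 (hs1.trans hs2).le, Nat.cast_add, Nat.cast_one,
      add_mul, one_mul]
    refine le_trans (add_le_add h2 (kadisonConstant_le τ (hR.band_mem_compactOps h hcomp hrn hrn')
      (hR.isStarProjection_band h hrn hrn') (hR.band_ne_zero h hrn hrn' hsD hs1 hs2))) ?_
    exact posTrace_add_le τ (hR.isStarProjection_band h hr0 hrn).nonneg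
      (hR.isStarProjection_band h hrn hrn').nonneg

end IsResolvent

end SpectralProjection

/-! ### Closed sets with finitely many gaps in bounded intervals -/

/-- A closed set of reals has band structure if there is a bound, in each interval `[-M, M]`, for
the length of a chain of points outside the set with points of the set between neighbours. The
bands are the connected components. -/
theorem hasBandStructure_of_gaps {S : Set ℝ} (hS : IsClosed S)
    (hgap : ∀ M : ℝ, ∃ n : ℕ, ∀ r : ℕ → ℝ, (∀ i ≤ n, r i ∉ S ∧ |r i| ≤ M) →
      ¬ ∀ i < n, ∃ s ∈ S, r i < s ∧ s < r (i + 1)) : HasBandStructure S := by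
  refine ⟨connectedComponentIn S '' S, ?_, ?_, ?_⟩
  · rintro _ ⟨x, hx, rfl⟩
    refine ⟨isClosed_of_closure_subset ?_, isPreconnected_connectedComponentIn.ordConnected⟩
    exact isPreconnected_connectedComponentIn.closure.subset_connectedComponentIn
      (subset_closure (mem_connectedComponentIn hx))
      (closure_minimal (connectedComponentIn_subset S x) hS)
  · intro x
    refine ⟨Set.Icc (x - 1) (x + 1), Icc_mem_nhds (by linarith) (by linarith), ?_⟩
    by_contra hinf
    have hch (I : {I : connectedComponentIn S '' S |
        ((I : Set ℝ) ∩ Set.Icc (x - 1) (x + 1)).Nonempty}) :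
        ∃ p : ℝ, connectedComponentIn S p = I.1 ∧ p ∈ S ∧ p ∈ Set.Icc (x - 1) (x + 1) := by
      obtain ⟨⟨_, y, hy, rfl⟩, p, hp, hpx⟩ := I
      exact ⟨p, (connectedComponentIn_eq hp).symm, connectedComponentIn_subset S y hp, hpx⟩
    choose p hp hpS hpx using hch
    have hinj : Function.Injective p := fun I J hIJ =>
      Subtype.ext (Subtype.ext (by rw [← hp I, ← hp J, hIJ]))
    have := Set.infinite_coe_iff.2 hinf
    have hT : (Set.range p).Infinite := Set.infinite_range_of_injective hinj
    have hsep {u v : ℝ} (hu : u ∈ Set.range p) (hv : v ∈ Set.range p) (huv : u < v) :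
        ∃ r, u < r ∧ r < v ∧ r ∉ S := by
      obtain ⟨I, rfl⟩ := hu
      obtain ⟨J, rfl⟩ := hv
      by_contra! hno
      have hsub : Set.Icc (p I) (p J) ⊆ S := fun r hr => by
        rcases hr.1.eq_or_lt with rfl | h1
        · exact hpS I
        rcases hr.2.eq_or_lt with rfl | h2
        · exact hpS J
        exact hno r h1 h2
      have h1 := isPreconnected_Icc.subset_connectedComponentIn
        (Set.left_mem_Icc.2 huv.le) hsub (Set.right_mem_Icc.2 huv.le)
      have h2 := connectedComponentIn_eq h1
      rw [hp, hp] at h2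
      exact huv.ne (congrArg p (Subtype.ext (Subtype.ext h2)))
    obtain ⟨n, hn⟩ := hgap (|x| + 1)
    -- `n + 2` points of the set give `n + 1` points outside the set between them
    obtain ⟨T, hTp, hTn⟩ := hT.exists_subset_card_eq (n + 2)
    let e := T.orderEmbOfFin hTn
    have he (i) : e i ∈ Set.range p := hTp (T.orderEmbOfFin_mem hTn i)
    have hr (i : ℕ) : ∃ r : ℝ, ∀ hi : i + 1 < n + 2,
        e ⟨i, by lia⟩ < r ∧ r < e ⟨i + 1, hi⟩ ∧ r ∉ S := by
      by_cases hi : i + 1 < n + 2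
      · obtain ⟨r, hr⟩ := hsep (he ⟨i, by lia⟩) (he ⟨i + 1, hi⟩)
          (e.strictMono (by simp [Fin.lt_def]))
        exact ⟨r, fun _ => hr⟩
      · exact ⟨0, fun h => absurd h hi⟩
    choose r hr using hr
    have hIcc (i) : e i ∈ S ∧ x - 1 ≤ e i ∧ e i ≤ x + 1 := by
      obtain ⟨I, hI⟩ := he i
      rw [← hI]
      exact ⟨hpS I, hpx I⟩
    refine hn r (fun i hi => ?_) fun i hi => ?_
    · obtain ⟨h1, h2, h3⟩ := hr i (by lia)
      refine ⟨h3, abs_le.2 ⟨?_, ?_⟩⟩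
      · linarith [(hIcc ⟨i, by lia⟩).2.1, neg_abs_le x]
      · linarith [(hIcc ⟨i + 1, by lia⟩).2.2, le_abs_self x]
    · exact ⟨e ⟨i + 1, by lia⟩, (hIcc _).1, (hr i (by lia)).2.1, (hr (i + 1) (by lia)).1⟩
  · refine Set.Subset.antisymm (fun x hx => ?_) (Set.sUnion_subset ?_)
    · exact ⟨_, ⟨x, hx, rfl⟩, mem_connectedComponentIn hx⟩
    · rintro _ ⟨x, -, rfl⟩
      exact connectedComponentIn_subset S x

end BlochTheory

end

theorem mainTheorem1 {A E : Type*} [CStarAlgebra A] [PartialOrder A] [StarOrderedRing A]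
    [NormedAddCommGroup E] [NormedSpace ℂ E] [CompleteSpace E] [Module A E] [CStarModule A E]
    (τ : BlochTheory.FaithfulTrace A) (hK : BlochTheory.HasKadisonProperty E τ)
    (D : E →ₗ.[A] E) (hD : BlochTheory.IsElliptic D) (hsa : BlochTheory.IsSelfAdjointOp D)
    (t : ℝ) (ht : 0 < t) (htr : BlochTheory.IsTraceClass τ (BlochTheory.heatOp D t)) :
    ∃ S : Set ℝ, BlochTheory.HasBandStructure S ∧
      BlochTheory.opSpectrum D = (fun x : ℝ => (x : ℂ)) '' S := by
  obtain ⟨R, hR⟩ := hsa.exists_resolvent hD.dense_range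
  obtain ⟨S, hSc, hS⟩ := hD.compact_resolvent
  have hcomp : star R * R ∈ BlochTheory.compactOps A E :=
    hR.eq_of_isInvOneAddAdjMul hsa hS ▸ hSc
  refine ⟨{x : ℝ | (x : ℂ) ∈ BlochTheory.opSpectrum D},
    BlochTheory.hasBandStructure_of_gaps (hR.isClosed_real_spectrum hsa) fun M => ?_, ?_⟩
  · have hpos : 0 ≤ BlochTheory.heatOp D t :=
      cfc_nonneg fun s _ => BlochTheory.heatFun_nonneg t s
    rw [BlochTheory.IsTraceClass, CFC.abs_of_nonneg _ hpos] at htr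
    -- the constant of `band_le_heatOp` for the interval `[-M, M]`; a chain with `n` gaps would
    -- have a spectral projection of trace at least `n` times the Kadison constant
    obtain ⟨n, hn⟩ := ENNReal.exists_nat_mul_gt (ne_of_gt hK)
      (ENNReal.mul_ne_top (ENNReal.ofReal_ne_top
        (r := Real.exp (t * ((M + 1) ^ 2 - 1)))) htr.ne)
    refine ⟨n, fun r hr hs => hn.not_ge ?_⟩
    refine (hR.nat_mul_kadisonConstant_le hsa hcomp τ r n (fun i hi => (hr i hi).1) hs).2.trans ?_
    refine (BlochTheory.posTrace_mono τ (hR.band_le_heatOp hsa ⟨S, hS⟩ ht M (hr 0 (by lia)).1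
      (hr n le_rfl).1 (hr 0 (by lia)).2 (hr n le_rfl).2)).trans ?_
    exact BlochTheory.posTrace_smul_le τ (Real.exp_pos _)
  · ext w
    constructor
    · intro hw
      have h1 := hR.opSpectrum_real hsa hw
      refine ⟨w.re, ?_, h1.symm⟩
      rw [Set.mem_ofPred_eq, ← h1]
      exact hw
    · rintro ⟨x, hx, rfl⟩
      exact hx
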